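/- There exist positive integers $k_n$ and a sequence of Boolean functions $f_n:\{-1,1\}^{k_n}\to\{-1,1\}$, $n\in\mathbb{N}$, such that: (i) each $f_n$ is transitive, i.e. there is a group of permutations of the coordinate set $\{1,\dots,k_n\}$ which acts transitively on it and under which $f_n$ is invariant; (ii) each $f_n$ is monotone increasing with respect to the coordinatewise order; (iii) the sequence is noise stable, i.e. $$\lim_{\epsilon\to 0^+}\ \sup_n\ \mathbb{P}\big[f_n(\omega)\neq f_n(N_\epsilon(\omega))\big]=0,$$ where $\omega$ is uniform on $\{-1,1\}^{k_n}$ and $N_\epsilon(\omega)$ is obtained from $\omega$ by resampling each of its bits independently with probability $\epsilon$ (a resampled bit is replaced by an independent uniform bit); (iv) the sequence is volatile, i.e. if $X_n(t)$ is the continuous-time random walk on the hypercube $\{-1,1\}^{k_n}$ started from the uniform distribution with rate $1$ clocks on the edges (each bit is flipped at the times of an independent Poisson process of rate $1$), and $C_n$ is the number of times $f_n(X_n(t))$ changes its value in the time interval $[0,1]$, then $C_n\to\infty$ in distribution, that is, $\mathbb{P}[C_n\le m]\to 0$ as $n\to\infty$ for every $m\in\mathbb{N}$. -/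

import Mathlib

open MeasureTheory ProbabilityTheory Filter Topology
open scoped ENNReal unitInterval

noncomputable section

namespace BooleanFunctions

/-- The hypercube `{-1, 1}^k`; the two-point set `{-1, 1}` is the unit group of `ℤ`, with its
order `-1 < 1`. -/
abbrev Cube (k : ℕ) : Type := Fin k → ℤˣ

/-- `f` is invariant under a group of permutations of the coordinates that acts transitively
on the coordinates. -/
def IsTransitive {k : ℕ} (f : Cube k → ℤˣ) : Prop :=
  ∃ G : Subgroup (Equiv.Perm (Fin k)), MulAction.IsPretransitive G (Fin k) ∧
    ∀ g ∈ G, ∀ ω : Cube k, f (fun i => ω (g i)) = f ω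

/-- The uniform probability measure on the hypercube. -/
def uniformCube (k : ℕ) : Measure (Cube k) := uniformOn Set.univ

instance : MeasurableSingletonClass ℤˣ :=
  ⟨fun x => ⟨{(x : ℤ)}, MeasurableSet.singleton _, by ext y; simp [Units.ext_iff]⟩⟩

instance (k : ℕ) : IsProbabilityMeasure (uniformCube k) :=
  isProbabilityMeasure_uniformOn Set.finite_univ Set.univ_nonempty

/-- The joint law of `(ω, b, ω')`: a uniform configuration `ω`, independent indicators `b i`
which are `true` with probability `ε`, and an independent uniform configuration `ω'`. -/
def noiseLaw (k : ℕ) (ε : I) : Measure (Cube k × (Fin k → Bool) × Cube k) :=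
  (uniformCube k).prod
    ((Measure.pi fun _ : Fin k => bernoulliMeasure true false ε).prod (uniformCube k))

/-- The noisy configuration: the bits marked by `b` are replaced by fresh ones. -/
def resample {k : ℕ} (ω : Cube k) (b : Fin k → Bool) (ω' : Cube k) : Cube k :=
  fun i => if b i then ω' i else ω i

/-- `P[f(ω) ≠ f(N_ε(ω))]`, where `N_ε(ω)` arises from the uniform configuration `ω` by resampling
each bit independently with probability `ε`. -/
def disagreement {k : ℕ} (f : Cube k → ℤˣ) (ε : I) : ℝ≥0∞ :=
  noiseLaw k ε {p | f p.1 ≠ f (resample p.1 p.2.1 p.2.2)}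

/-- `lim_{ε → 0} sup_n P[f_n(ω) ≠ f_n(N_ε(ω))] = 0`. -/
def NoiseStable {k : ℕ → ℕ} (f : ∀ n, Cube (k n) → ℤˣ) : Prop :=
  Tendsto (fun ε : I => ⨆ n, disagreement (f n) ε) (𝓝[>] 0) (𝓝 0)

/-- The sample space of the walk: a starting point, and for each of the `k` directions the waiting
times between consecutive rings of the clock of that direction. -/
abbrev WalkSpace (k : ℕ) : Type := Cube k × (Fin k → ℕ → ℝ)

/-- The starting point is uniform and all waiting times are exponential of rate `1`, everything
being independent: the clocks are independent Poisson processes of rate `1`. -/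
def walkLaw (k : ℕ) : Measure (WalkSpace k) :=
  (uniformCube k).prod
    (Measure.pi fun _ : Fin k => Measure.infinitePi fun _ : ℕ => expMeasure 1)

instance (k : ℕ) : IsProbabilityMeasure (walkLaw k) := by
  have : IsProbabilityMeasure (expMeasure 1) := isProbabilityMeasure_expMeasure one_pos
  unfold walkLaw
  infer_instance

/-- The number of rings up to time `t` of a clock with waiting times `τ 0, τ 1, …`; the `m`-th ring
(counted from `0`) is at time `τ 0 + ⋯ + τ m`. (Almost surely only finitely many rings occur up to
time `t`.) -/
def rings (τ : ℕ → ℝ) (t : ℝ) : ℕ :=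
  {m : ℕ | ∑ j ∈ Finset.range (m + 1), τ j ≤ t}.ncard

/-- The position at time `t` of the continuous time random walk on the hypercube: whenever the
clock of direction `i` rings, the walk crosses the edge in direction `i` at its present position,
that is, its `i`-th bit is flipped. Thus each edge at the present position is crossed at
rate `1`. -/
def walk {k : ℕ} (p : WalkSpace k) (t : ℝ) : Cube k :=
  fun i => (-1) ^ rings (p.2 i) t * p.1 i

/-- The number of times that `g` changes its value on the time interval `[0, 1]`: the largest `m`
(or `∞`) such that there are times `t_0 < t_1 < ⋯ < t_m` in `[0, 1]` with
`g (t_{i}) ≠ g (t_{i+1})` for all `i < m`. For a right-continuous step function this is its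
number of jumps. -/
def numChanges (g : ℝ → ℤˣ) : ℕ∞ :=
  ⨆ (m : ℕ) (_ : ∃ t : Fin (m + 1) → ℝ, StrictMono t ∧ (∀ i, t i ∈ Set.Icc (0 : ℝ) 1) ∧
    ∀ i : Fin m, g (t i.castSucc) ≠ g (t i.succ)), (m : ℕ∞)

/-- The number `C` of value changes of `f(X(t))` on `[0, 1]`, for the random walk `X`. -/
def walkChanges {k : ℕ} (f : Cube k → ℤˣ) (p : WalkSpace k) : ℕ∞ :=
  numChanges fun t => f (walk p t)

/-- `C_n` tends to infinity in distribution: `P[C_n ≤ m] → 0` for every `m`. -/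
def Volatile {k : ℕ → ℕ} (f : ∀ n, Cube (k n) → ℤˣ) : Prop :=
  ∀ m : ℕ, Tendsto (fun n => walkLaw (k n) {p | walkChanges (f n) p ≤ (m : ℕ∞)}) atTop (𝓝 0)

end BooleanFunctions

end

namespace BooleanFunctions

/-! ### Majority modified by two-sided tribes -/

/-! Take majority on `m` tribes of `L` bits and let a unanimous tribe overrule it, with `1` winning
ties. Everything rests on separating the probability of unanimity at a fixed time from its
occurrence during a time interval.

At a fixed time some tribe unanimously votes a given sign with probability at most `m * 2⁻¹ ^ L`. If
this tends to `0`, the function agrees with majority with high probability, and it inherits noise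
stability from majority (`majority_ne_le`, `disagreement_tribesMajority_le`).

Along the walk, unanimity of a tribe loses a constant factor of its correlation over times of order
`1 / L`, so a unit interval offers about `L` fresh chances. If `m * L * 2⁻¹ ^ L → ∞`, a second
moment bound (`walkLaw_no_hit_le`) shows that every interval of fixed length contains times of
unanimity for `1` and times of unanimity for `-1`. If also `L * (m * 2⁻¹ ^ L) ^ 2 → 0`, the two
signs do not conflict at the grid times used, so the value alternates from interval to interval
(`lt_walkChanges`).

With `L = 16 ^ n` and `m = 2 ^ (L - 3 * n)` the three quantities are `8 ^ (-n)`, `2 ^ n` and `4 ^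
(-n)`. -/

/-- The `a`-th of the `m` consecutive blocks of `L` coordinates. -/
def tribe (m L : ℕ) (a : Fin m) : Finset (Fin (m * L)) :=
  Finset.univ.filter fun i => i.divNat = a

lemma mem_tribe {m L : ℕ} {a : Fin m} {i : Fin (m * L)} : i ∈ tribe m L a ↔ i.divNat = a := by
  simp [tribe]

lemma card_tribe (m L : ℕ) (a : Fin m) : (tribe m L a).card = L := by
  have h : tribe m L a = (Finset.univ : Finset (Fin L)).map
      ⟨fun j => finProdFinEquiv (a, j), fun x y h => by simpa using h⟩ := by
    ext i
    obtain ⟨⟨b, j⟩, rfl⟩ := finProdFinEquiv.surjective i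
    have : (finProdFinEquiv (b, j)).divNat = b :=
      congrArg Prod.fst (finProdFinEquiv.symm_apply_apply (b, j))
    rw [mem_tribe, this, Finset.mem_map]
    constructor
    · rintro rfl
      exact ⟨j, Finset.mem_univ _, rfl⟩
    · rintro ⟨j', -, h⟩
      exact (congrArg Prod.fst (finProdFinEquiv.injective h)).symm
  rw [h, Finset.card_map, Finset.card_univ, Fintype.card_fin]

lemma disjoint_tribe {m L : ℕ} {a b : Fin m} (h : a ≠ b) :
    Disjoint (tribe m L a) (tribe m L b) := by
  rw [Finset.disjoint_left]
  intro i hi hj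
  exact h ((mem_tribe.1 hi).symm.trans (mem_tribe.1 hj))

/-- The configurations in which some tribe unanimously votes `c`. -/
def unanimous (m L : ℕ) (c : ℤˣ) : Set (Cube (m * L)) :=
  {ω | ∃ a, ∀ i ∈ tribe m L a, ω i = c}

/-- The majority vote. -/
def majority (k : ℕ) (ω : Cube k) : ℤˣ := if 0 ≤ ∑ i, (ω i : ℤ) then 1 else -1

open Classical in
/-- A unanimous tribe decides the outcome, with preference for `1`; in the absence of unanimous
tribes the majority decides. -/
noncomputable def tribesMajority (m L : ℕ) (ω : Cube (m * L)) : ℤˣ :=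
  if ω ∈ unanimous m L 1 then 1 else if ω ∈ unanimous m L (-1) then -1 else majority _ ω

/-! ### Monotonicity and transitivity. -/

lemma unit_le_one (x : ℤˣ) : x ≤ 1 := by
  rcases Int.units_eq_one_or x with rfl | rfl <;> decide

lemma neg_one_le_unit (x : ℤˣ) : -1 ≤ x := by
  rcases Int.units_eq_one_or x with rfl | rfl <;> decide

lemma monotone_majority (k : ℕ) : Monotone (majority k) := by
  intro ω ω' h
  have hs : ∑ i, (ω i : ℤ) ≤ ∑ i, (ω' i : ℤ) := Finset.sum_le_sum fun i _ => h i
  unfold majority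
  split_ifs with h1 h2
  · exact le_rfl
  · exact absurd (h1.trans hs) h2
  · exact neg_one_le_unit _
  · exact le_rfl

lemma monotone_tribesMajority (m L : ℕ) : Monotone (tribesMajority m L) := by
  intro ω ω' h
  have h1 : ω ∈ unanimous m L 1 → ω' ∈ unanimous m L 1 := fun ⟨a, ha⟩ =>
    ⟨a, fun i hi => le_antisymm (unit_le_one _) (ha i hi ▸ h i)⟩
  have h2 : ω' ∈ unanimous m L (-1) → ω ∈ unanimous m L (-1) := fun ⟨a, ha⟩ =>
    ⟨a, fun i hi => le_antisymm (ha i hi ▸ h i) (neg_one_le_unit _)⟩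
  unfold tribesMajority
  split_ifs
  all_goals first
    | exact unit_le_one _
    | exact neg_one_le_unit _
    | exact monotone_majority _ h
    | tauto

lemma majority_comp_perm {k : ℕ} (g : Equiv.Perm (Fin k)) (ω : Cube k) :
    majority k (fun i => ω (g i)) = majority k ω := by
  simp only [majority, Equiv.sum_comp g fun i => (ω i : ℤ)]

lemma unanimous_comp_perm {m L : ℕ} (e : Equiv.Perm (Fin m)) (g : Equiv.Perm (Fin (m * L)))
    (hg : ∀ i, (g i).divNat = e i.divNat) (c : ℤˣ) (ω : Cube (m * L)) :
    (fun i => ω (g i)) ∈ unanimous m L c ↔ ω ∈ unanimous m L c := by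
  constructor
  · rintro ⟨a, ha⟩
    refine ⟨e a, fun i hi => ?_⟩
    have := ha (g.symm i) (mem_tribe.2 (e.injective ?_))
    · simpa using this
    · rw [← hg, Equiv.apply_symm_apply, mem_tribe.1 hi]
  · rintro ⟨a, ha⟩
    refine ⟨e.symm a, fun i hi => ha _ (mem_tribe.2 ?_)⟩
    rw [hg, mem_tribe.1 hi, Equiv.apply_symm_apply]

lemma tribesMajority_comp_perm {m L : ℕ} (e : Equiv.Perm (Fin m)) (g : Equiv.Perm (Fin (m * L)))
    (hg : ∀ i, (g i).divNat = e i.divNat) (ω : Cube (m * L)) :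
    tribesMajority m L (fun i => ω (g i)) = tribesMajority m L ω := by
  classical
  exact if_congr (unanimous_comp_perm e g hg 1 ω) rfl
    (if_congr (unanimous_comp_perm e g hg (-1) ω) rfl (majority_comp_perm g ω))

lemma isTransitive_tribesMajority (m L : ℕ) : IsTransitive (tribesMajority m L) := by
  -- The group is the full stabilizer of the function. A swap of two tribes combined with a swap of
  -- two positions inside the tribes carries any coordinate to any other.
  refine ⟨{ carrier := {g | ∀ ω : Cube (m * L), tribesMajority m L (fun i => ω (g i)) =
              tribesMajority m L ω}
            mul_mem' := fun {g h} hg hh ω => (hh fun i => ω (g i)).trans (hg ω)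
            one_mem' := fun _ => rfl
            inv_mem' := fun {g} hg ω => ?_ }, ⟨fun x y => ?_⟩, fun g hg => hg⟩
  · have := hg fun i => ω (g⁻¹ i)
    simpa using this.symm
  · obtain ⟨⟨a, i⟩, rfl⟩ := finProdFinEquiv.surjective x
    obtain ⟨⟨b, j⟩, rfl⟩ := finProdFinEquiv.surjective y
    refine ⟨⟨finProdFinEquiv.permCongr ((Equiv.swap a b).prodCongr (Equiv.swap i j)),
      tribesMajority_comp_perm (Equiv.swap a b) _ fun l => ?_⟩, ?_⟩
    · obtain ⟨⟨b', j'⟩, rfl⟩ := finProdFinEquiv.surjective l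
      have h (p : Fin m × Fin L) : (finProdFinEquiv p).divNat = p.1 :=
        congrArg Prod.fst (finProdFinEquiv.symm_apply_apply p)
      rw [Equiv.permCongr_apply, Equiv.symm_apply_apply, h, h]
      rfl
    · change finProdFinEquiv.permCongr _ _ = _
      rw [Equiv.permCongr_apply, Equiv.symm_apply_apply]
      simp

/-! ### The uniform measure -/

lemma uniformCube_eq_pi (k : ℕ) :
    uniformCube k = Measure.pi fun _ : Fin k => uniformOn (Set.univ : Set ℤˣ) := by
  rw [uniformCube, ← Set.pi_univ Set.univ, uniformOn_pi]

lemma uniformOn_units_singleton (c : ℤˣ) : uniformOn (Set.univ : Set ℤˣ) {c} = 2⁻¹ := by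
  rw [uniformOn_univ, Measure.count_singleton]
  simp

/-- The target `c` varies with the coordinate so that it can absorb the signs that the clocks
contribute to the walk. -/
lemma uniformCube_cylinder {k : ℕ} (S : Finset (Fin k)) (c : Cube k) :
    uniformCube k {ω | ∀ i ∈ S, ω i = c i} = 2⁻¹ ^ S.card := by
  classical
  have : IsProbabilityMeasure (uniformOn (Set.univ : Set ℤˣ)) :=
    isProbabilityMeasure_uniformOn Set.finite_univ Set.univ_nonempty
  have h : {ω : Cube k | ∀ i ∈ S, ω i = c i} =
      Set.univ.pi fun i => if i ∈ S then {c i} else Set.univ := by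
    ext ω
    simp only [Set.mem_ofPred_eq, Set.mem_pi, Set.mem_univ, true_implies]
    refine forall_congr' fun i => ?_
    by_cases hi : i ∈ S <;> simp [hi]
  rw [h, uniformCube_eq_pi, Measure.pi_pi]
  have h2 (i : Fin k) : uniformOn (Set.univ : Set ℤˣ) (if i ∈ S then {c i} else Set.univ) =
      if i ∈ S then 2⁻¹ else 1 := by
    split_ifs
    · exact uniformOn_units_singleton _
    · exact measure_univ
  simp only [h2, Finset.prod_ite_mem, Finset.univ_inter, Finset.prod_const]

lemma uniformCube_apply {k : ℕ} (s : Set (Cube k)) [DecidablePred (· ∈ s)] :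
    uniformCube k s = (Finset.univ.filter (· ∈ s)).card / 2 ^ k := by
  have h : s = (Finset.univ.filter (· ∈ s) : Finset (Cube k)) := by simp
  rw [uniformCube, uniformOn_univ]
  nth_rw 1 [h]
  rw [Measure.count_apply_finset]
  simp

/-! ### A second moment bound -/

/-- Chebyshev: for the number `X` of occurring events, with mean `μ`, one has `(X - μ) ^ 2 = μ ^ 2`
where no event occurs, and the right side is the variance of `X`. -/
lemma sq_mul_measureReal_compl_iUnion_le {Ω ι : Type*} [MeasurableSpace Ω] [Fintype ι]
    (P : Measure Ω) [IsProbabilityMeasure P] (E : ι → Set Ω) (hE : ∀ x, MeasurableSet (E x)) :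
    (∑ x, P.real (E x)) ^ 2 * P.real (⋃ x, E x)ᶜ ≤
      ∑ x, ∑ y, P.real (E x ∩ E y) - (∑ x, P.real (E x)) ^ 2 := by
  set μ := ∑ x, P.real (E x)
  let X : Ω → ℝ := fun ω => ∑ x, (E x).indicator 1 ω
  have hi (s : Set Ω) (hs : MeasurableSet s) : Integrable (s.indicator (1 : Ω → ℝ)) P :=
    (integrable_const (1 : ℝ)).indicator hs
  have hX : Integrable X P := integrable_finsetSum _ fun x _ => hi _ (hE x)
  have hXX : (fun ω => X ω ^ 2) = fun ω => ∑ x, ∑ y, (E x ∩ E y).indicator (1 : Ω → ℝ) ω := by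
    ext ω
    simp only [X, sq, Finset.sum_mul_sum, Set.inter_indicator_one, Pi.mul_apply]
  have hX2 : Integrable (fun ω => X ω ^ 2) P := by
    rw [hXX]
    exact integrable_finsetSum _ fun x _ => integrable_finsetSum _ fun y _ =>
      hi _ ((hE x).inter (hE y))
  have e1 : ∫ ω, X ω ∂P = μ := by
    rw [integral_finsetSum _ fun x _ => hi _ (hE x)]
    exact Finset.sum_congr rfl fun x _ => integral_indicator_one (hE x)
  have e2 : ∫ ω, X ω ^ 2 ∂P = ∑ x, ∑ y, P.real (E x ∩ E y) := by
    rw [hXX, integral_finsetSum _ fun x _ => integrable_finsetSum _ fun y _ =>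
      hi _ ((hE x).inter (hE y))]
    refine Finset.sum_congr rfl fun x _ => ?_
    rw [integral_finsetSum _ fun y _ => hi _ ((hE x).inter (hE y))]
    exact Finset.sum_congr rfl fun y _ => integral_indicator_one ((hE x).inter (hE y))
  have e3 : ∫ ω, (X ω ^ 2 - (2 * μ) * X ω + μ ^ 2) ∂P =
      ∑ x, ∑ y, P.real (E x ∩ E y) - μ ^ 2 := by
    have hX3 : Integrable (fun ω => X ω ^ 2 - (2 * μ) * X ω) P := hX2.sub (hX.const_mul _)
    rw [integral_add hX3 (integrable_const _), integral_sub hX2 (hX.const_mul _),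
      integral_const_mul, e1, e2]
    simp
    ring
  have hU : MeasurableSet (⋃ x, E x)ᶜ := (MeasurableSet.iUnion hE).compl
  rw [← e3, ← integral_indicator_one hU, ← integral_const_mul]
  refine integral_mono ((hi _ hU).const_mul _)
    ((hX2.sub (hX.const_mul _)).add (integrable_const _)) fun ω => ?_
  by_cases h : ω ∈ ⋃ x, E x
  · simp only [Set.indicator_of_notMem (Set.notMem_compl_iff.2 h), mul_zero]
    nlinarith [sq_nonneg (X ω - μ)]
  · have h1 : (⋃ x, E x)ᶜ.indicator (1 : Ω → ℝ) ω = 1 := Set.indicator_of_mem (Set.mem_compl h) _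
    have h0 : X ω = 0 := Finset.sum_eq_zero fun x _ =>
      Set.indicator_of_notMem (fun hx => h (Set.mem_iUnion_of_mem x hx)) _
    simp only [h1, h0]
    linarith

/-! ### The clocks -/

lemma measurable_rings (t : ℝ) : Measurable fun τ : ℕ → ℝ => rings τ t := by
  unfold rings
  refine measurable_ncard.comp (measurable_set_iff.2 fun m => ?_)
  have h : MeasurableSet {τ : ℕ → ℝ | ∑ j ∈ Finset.range (m + 1), τ j ≤ t} :=
    measurableSet_le (by fun_prop) measurable_const
  exact measurable_mem.2 h

lemma rings_eq_zero {τ : ℕ → ℝ} {s : ℝ} (h : ∀ j, 0 ≤ τ j) (h0 : s < τ 0) : rings τ s = 0 := by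
  have : {m : ℕ | ∑ j ∈ Finset.range (m + 1), τ j ≤ s} = ∅ := by
    refine Set.eq_empty_of_forall_notMem fun m hm => not_lt.2 hm (h0.trans_le ?_)
    exact Finset.single_le_sum (fun j _ => h j) (Finset.mem_range.2 m.succ_pos)
  rw [rings, this, Set.ncard_empty]

/-- The condition `t < τ 1` is cruder than `t < τ 0 + τ 1`, but it is independent of the condition
on `τ 0`. -/
lemma rings_eq_one {τ : ℕ → ℝ} {t : ℝ} (h : ∀ j, 0 ≤ τ j) (h0 : τ 0 ≤ t) (h1 : t < τ 1) :
    rings τ t = 1 := by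
  have : {m : ℕ | ∑ j ∈ Finset.range (m + 1), τ j ≤ t} = {0} := by
    refine Set.Subset.antisymm (fun m hm => ?_) (Set.singleton_subset_iff.2 ?_)
    · by_contra hm0
      have hm1 : 1 < m + 1 := Nat.succ_lt_succ (Nat.pos_of_ne_zero hm0)
      exact not_lt.2 hm (h1.trans_le
        (Finset.single_le_sum (fun j _ => h j) (Finset.mem_range.2 hm1)))
    · simpa using h0
  rw [rings, this, Set.ncard_singleton]

instance : IsProbabilityMeasure (expMeasure 1) := isProbabilityMeasure_expMeasure one_pos

/-- The law of the waiting times of a single clock. -/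
noncomputable def clockLaw : Measure (ℕ → ℝ) := Measure.infinitePi fun _ : ℕ => expMeasure 1

instance : IsProbabilityMeasure clockLaw := by
  unfold clockLaw; infer_instance

lemma expMeasure_Iic {x : ℝ} (hx : 0 ≤ x) :
    (expMeasure 1).real (Set.Iic x) = 1 - Real.exp (-x) := by
  have := cdf_expMeasure_eq one_pos x
  rw [cdf_eq_real, if_pos hx, one_mul] at this
  exact this

lemma expMeasure_Ioi {x : ℝ} (hx : 0 ≤ x) : (expMeasure 1).real (Set.Ioi x) = Real.exp (-x) := by
  rw [← Set.compl_Iic, probReal_compl_eq_one_sub measurableSet_Iic, expMeasure_Iic hx]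
  ring

lemma expMeasure_Ioc {s t : ℝ} (hs : 0 ≤ s) (hst : s ≤ t) :
    (expMeasure 1).real (Set.Ioc s t) = Real.exp (-s) - Real.exp (-t) := by
  rw [← Set.Ioi_sdiff_Ioi, measureReal_sdiff (Set.Ioi_subset_Ioi hst) measurableSet_Ioi,
    expMeasure_Ioi hs, expMeasure_Ioi (hs.trans hst)]

lemma ae_clockLaw_nonneg : ∀ᵐ τ ∂clockLaw, ∀ j, 0 ≤ τ j := by
  rw [ae_all_iff]
  intro j
  have h : ∀ᵐ x ∂expMeasure 1, 0 ≤ x := by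
    rw [ae_iff]
    have := expMeasure_Iic le_rfl
    rw [neg_zero, Real.exp_zero, sub_self, measureReal_eq_zero_iff] at this
    exact measure_mono_null (fun x hx => (not_le.1 hx).le) this
  exact (measurePreserving_eval_infinitePi
    (fun _ : ℕ => expMeasure 1) j).quasiMeasurePreserving.ae h

/-- If the first waiting time lies in `(s, t]` and the second exceeds `1`, the clock has rung `0`
times at `s` and once at `t`. The two independent conditions have probabilities at least `exp (-1) *
(t - s)` and equal to `exp (-1)`. -/
lemma clockLaw_same_parity_le {s t : ℝ} (hs : 0 ≤ s) (hst : s ≤ t) (ht : t ≤ 1) :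
    clockLaw.real {τ | (-1 : ℤˣ) ^ rings τ s = (-1) ^ rings τ t} ≤
      1 - Real.exp (-2) * (t - s) := by
  have hm : MeasurableSet {τ | (-1 : ℤˣ) ^ rings τ s = (-1) ^ rings τ t} :=
    measurableSet_eq_fun (measurable_from_nat.comp (measurable_rings s))
      (measurable_from_nat.comp (measurable_rings t))
  let A : ℕ → Set ℝ := fun j => if j = 0 then Set.Ioc s t else Set.Ioi 1
  have hA : clockLaw.real (((({0, 1} : Finset ℕ)) : Set ℕ).pi A) =
      (Real.exp (-s) - Real.exp (-t)) * Real.exp (-1) := by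
    rw [measureReal_def, clockLaw, Measure.infinitePi_pi, Finset.prod_pair zero_ne_one,
      ENNReal.toReal_mul, ← measureReal_def, ← measureReal_def]
    · simp only [A, if_pos, one_ne_zero, if_false]
      rw [expMeasure_Ioc hs hst, expMeasure_Ioi zero_le_one]
    · intro i _
      by_cases hi : i = 0 <;> simp [A, hi]
  have hle : clockLaw.real (((({0, 1} : Finset ℕ)) : Set ℕ).pi A) ≤
      clockLaw.real {τ | (-1 : ℤˣ) ^ rings τ s = (-1) ^ rings τ t}ᶜ := by
    refine ENNReal.toReal_mono (measure_ne_top _ _) (measure_mono_ae ?_)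
    filter_upwards [ae_clockLaw_nonneg] with τ hτ hτA
    have h0 : τ 0 ∈ Set.Ioc s t := by simpa [A] using hτA 0 (by simp)
    have h1 : τ 1 ∈ Set.Ioi 1 := by simpa [A] using hτA 1 (by simp)
    change ¬ (-1 : ℤˣ) ^ rings τ s = (-1) ^ rings τ t
    rw [rings_eq_zero hτ h0.1, rings_eq_one hτ h0.2 (ht.trans_lt h1)]
    decide
  rw [probReal_compl_eq_one_sub hm, hA] at hle
  have h3 : Real.exp (-1) * (t - s) ≤ Real.exp (-s) - Real.exp (-t) := by
    have h4 : Real.exp (-s) = Real.exp (-t) * Real.exp (t - s) := by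
      rw [← Real.exp_add]; ring_nf
    have h5 : Real.exp (-1) ≤ Real.exp (-t) := Real.exp_le_exp.2 (by linarith)
    have h6 := Real.add_one_le_exp (t - s)
    have h7 := Real.exp_pos (-t)
    rw [h4]
    nlinarith
  have h8 : Real.exp (-2) = Real.exp (-1) * Real.exp (-1) := by
    rw [← Real.exp_add]; norm_num
  rw [h8]
  nlinarith [Real.exp_pos (-1)]

/-! ### The walk at fixed times -/

lemma measurable_walk_apply {k : ℕ} (t : ℝ) (i : Fin k) :
    Measurable fun p : WalkSpace k => walk p t i := by
  have h1 : Measurable fun p : WalkSpace k => (-1 : ℤˣ) ^ rings (p.2 i) t :=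
    (measurable_from_nat (f := fun n => (-1 : ℤˣ) ^ n)).comp
      ((measurable_rings t).comp ((measurable_pi_apply i).comp measurable_snd))
  have h2 : Measurable fun p : WalkSpace k => p.1 i :=
    (measurable_pi_apply i).comp measurable_fst
  have h3 : Measurable fun x : ℤˣ × ℤˣ => x.1 * x.2 := measurable_of_finite _
  exact h3.comp (h1.prodMk h2)

/-- At time `t` the `a`-th tribe unanimously votes `c`. -/
def tribeVotes (m L : ℕ) (c : ℤˣ) (a : Fin m) (t : ℝ) : Set (WalkSpace (m * L)) :=
  {p | ∀ i ∈ tribe m L a, walk p t i = c}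

lemma measurableSet_walk_cylinder {k : ℕ} (S : Finset (Fin k)) (u : Fin k → ℝ) (c : Cube k) :
    MeasurableSet {p : WalkSpace k | ∀ i ∈ S, walk p (u i) i = c i} := by
  have : {p : WalkSpace k | ∀ i ∈ S, walk p (u i) i = c i} =
      ⋂ i ∈ S, (fun p => walk p (u i) i) ⁻¹' {c i} := by
    ext p; simp
  rw [this]
  exact S.measurableSet_biInter fun i _ => measurable_walk_apply _ _ (measurableSet_singleton _)

lemma measurableSet_tribeVotes (m L : ℕ) (c : ℤˣ) (a : Fin m) (t : ℝ) :
    MeasurableSet (tribeVotes m L c a t) :=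
  measurableSet_walk_cylinder _ (fun _ => t) fun _ => c

lemma walk_eq_iff {k : ℕ} (ω : Cube k) (τ : Fin k → ℕ → ℝ) (t : ℝ) (i : Fin k) (c : ℤˣ) :
    walk (ω, τ) t i = c ↔ ω i = (-1) ^ rings (τ i) t * c := by
  change (-1) ^ rings (τ i) t * ω i = c ↔ _
  rw [← eq_inv_mul_iff_mul_eq, Int.units_inv_eq_self]

lemma walkLaw_eq (k : ℕ) :
    walkLaw k = (uniformCube k).prod (Measure.pi fun _ : Fin k => clockLaw) := rfl

/-- For frozen clocks the event is again a cylinder for the uniform starting point. The observation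
time may depend on the coordinate, which yields independence of different tribes at different times.
-/
lemma walkLaw_cylinder {k : ℕ} (S : Finset (Fin k)) (u : Fin k → ℝ) (c : Cube k) :
    walkLaw k {p | ∀ i ∈ S, walk p (u i) i = c i} = 2⁻¹ ^ S.card := by
  rw [walkLaw_eq, Measure.prod_apply_symm (measurableSet_walk_cylinder S u c)]
  have (τ : Fin k → ℕ → ℝ) : uniformCube k ((fun ω => (ω, τ)) ⁻¹'
      {p : WalkSpace k | ∀ i ∈ S, walk p (u i) i = c i}) = 2⁻¹ ^ S.card := by
    rw [← uniformCube_cylinder S fun i => (-1) ^ rings (τ i) (u i) * c i]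
    congr 1
    ext ω
    exact forall₂_congr fun i _ => walk_eq_iff ω τ (u i) i (c i)
  simp only [this, lintegral_const, measure_univ, mul_one]

lemma walkLaw_cylinder_inter_le {k : ℕ} (S : Finset (Fin k)) (c : ℤˣ) {s t : ℝ}
    (hs : 0 ≤ s) (hst : s ≤ t) (ht : t ≤ 1) :
    (walkLaw k).real {p | (∀ i ∈ S, walk p s i = c) ∧ ∀ i ∈ S, walk p t i = c} ≤
      2⁻¹ ^ S.card * (1 - Real.exp (-2) * (t - s)) ^ S.card := by
  classical
  let B : Set (ℕ → ℝ) := {τ | (-1 : ℤˣ) ^ rings τ s = (-1) ^ rings τ t}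
  let T : Set (Fin k → ℕ → ℝ) := Set.univ.pi fun i => if i ∈ S then B else Set.univ
  have hB : MeasurableSet B :=
    measurableSet_eq_fun (measurable_from_nat.comp (measurable_rings s))
      (measurable_from_nat.comp (measurable_rings t))
  have hT : MeasurableSet T := MeasurableSet.univ_pi fun i => by
    by_cases hi : i ∈ S <;> simp [hi, hB]
  have key : walkLaw k {p | (∀ i ∈ S, walk p s i = c) ∧ ∀ i ∈ S, walk p t i = c} ≤
      2⁻¹ ^ S.card * clockLaw B ^ S.card := by
    rw [walkLaw_eq, Measure.prod_apply_symm]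
    · calc _ ≤ ∫⁻ τ, T.indicator (fun _ => 2⁻¹ ^ S.card) τ
              ∂Measure.pi fun _ : Fin k => clockLaw := by
            refine lintegral_mono fun τ => ?_
            -- For frozen clocks, a coordinate of `S` whose ring parity differs at `s` and `t` makes
            -- the event impossible; otherwise the condition at time `s` alone bounds it.
            by_cases hτ : τ ∈ T
            · rw [Set.indicator_of_mem hτ,
                ← uniformCube_cylinder S fun i => (-1) ^ rings (τ i) s * c]
              exact measure_mono fun ω hω i hi => (walk_eq_iff ω τ s i c).1 (hω.1 i hi)
            · rw [Set.indicator_of_notMem hτ, nonpos_iff_eq_zero]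
              refine measure_mono_null (t := ∅) (fun ω hω => hτ fun i _ => ?_) measure_empty
              by_cases hi : i ∈ S
              · have h1 := (walk_eq_iff ω τ s i c).1 (hω.1 i hi)
                have h2 := (walk_eq_iff ω τ t i c).1 (hω.2 i hi)
                simpa [hi, B] using h1.symm.trans h2
              · simp [hi]
        _ = _ := by
            rw [lintegral_indicator_const hT, Measure.pi_pi]
            congr 1
            have (i : Fin k) : clockLaw (if i ∈ S then B else Set.univ) =
                if i ∈ S then clockLaw B else 1 := by
              split_ifs
              · rfl
              · exact measure_univ
            simp only [this, Finset.prod_ite_mem, Finset.univ_inter, Finset.prod_const]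
    · exact (measurableSet_walk_cylinder S (fun _ => s) fun _ => c).inter
        (measurableSet_walk_cylinder S (fun _ => t) fun _ => c)
  calc _ ≤ (2⁻¹ ^ S.card * clockLaw B ^ S.card).toReal :=
        ENNReal.toReal_mono (by finiteness) key
    _ = 2⁻¹ ^ S.card * clockLaw.real B ^ S.card := by simp [measureReal_def]
    _ ≤ _ := by
        gcongr
        exact clockLaw_same_parity_le hs hst ht

lemma walkLaw_tribeVotes (m L : ℕ) (c : ℤˣ) (a : Fin m) (t : ℝ) :
    (walkLaw (m * L)).real (tribeVotes m L c a t) = 2⁻¹ ^ L := by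
  rw [measureReal_def, tribeVotes, walkLaw_cylinder _ (fun _ => t) fun _ => c, card_tribe]
  simp

lemma walkLaw_tribeVotes_inter_of_ne {m L : ℕ} {a b : Fin m} (hab : a ≠ b) (c d : ℤˣ) (s t : ℝ) :
    (walkLaw (m * L)).real (tribeVotes m L c a s ∩ tribeVotes m L d b t) = 2⁻¹ ^ L * 2⁻¹ ^ L := by
  have h : tribeVotes m L c a s ∩ tribeVotes m L d b t =
      {p | ∀ i ∈ tribe m L a ∪ tribe m L b, walk p (if i ∈ tribe m L a then s else t) i =
        (fun i => if i ∈ tribe m L a then c else d) i} := by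
    ext p
    have hd := Finset.disjoint_right.1 (disjoint_tribe (L := L) hab)
    constructor
    · rintro ⟨h1, h2⟩ i hi
      by_cases hia : i ∈ tribe m L a
      · simpa [hia] using h1 i hia
      · simpa [hia] using h2 i ((Finset.mem_union.1 hi).resolve_left hia)
    · intro h
      refine ⟨fun i hi => ?_, fun i hi => ?_⟩
      · simpa [hi] using h i (Finset.mem_union_left _ hi)
      · simpa [hd hi] using h i (Finset.mem_union_right _ hi)
  rw [h, measureReal_def, walkLaw_cylinder, Finset.card_union_of_disjoint (disjoint_tribe hab),
    card_tribe, card_tribe, ← pow_add]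
  simp

lemma walkLaw_tribeVotes_inter_le {m L : ℕ} (a : Fin m) (c : ℤˣ) {s t : ℝ}
    (hs : s ∈ Set.Icc (0 : ℝ) 1) (ht : t ∈ Set.Icc (0 : ℝ) 1) :
    (walkLaw (m * L)).real (tribeVotes m L c a s ∩ tribeVotes m L c a t) ≤
      2⁻¹ ^ L * Real.exp (-(Real.exp (-2) * |t - s|) * L) := by
  wlog hst : s ≤ t generalizing s t
  · rw [Set.inter_comm, abs_sub_comm]
    exact this ht hs (le_of_not_ge hst)
  have h := walkLaw_cylinder_inter_le (tribe m L a) c hs.1 hst ht.2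
  rw [card_tribe] at h
  refine h.trans ?_
  have h2 : Real.exp (-2) ≤ 1 := Real.exp_le_one_iff.2 (by norm_num)
  rw [abs_of_nonneg (sub_nonneg.2 hst), mul_comm _ (L : ℝ), Real.exp_nat_mul]
  gcongr
  · nlinarith [hs.1, ht.2, Real.exp_pos (-2)]
  · have := Real.add_one_le_exp (-(Real.exp (-2) * (t - s)))
    linarith

/-! ### Unanimous tribes occur in every time interval -/

lemma sum_pow_le_of_injOn {α : Type*} (s : Finset α) (g : α → ℕ) (hg : Set.InjOn g s) {r : ℝ}
    (h0 : 0 ≤ r) (h1 : r < 1) : ∑ x ∈ s, r ^ g x ≤ (1 - r)⁻¹ := by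
  classical
  rw [← Finset.sum_image (f := fun n => r ^ n) hg, ← tsum_geometric_of_lt_one h0 h1]
  exact (summable_geometric_of_lt_one h0 h1).sum_le_tsum _ fun n _ => pow_nonneg h0 n

/-- On each side of `j` the distance to `j` is injective, so each side is bounded by one geometric
series. -/
lemma sum_pow_dist_le {L : ℕ} (j : Fin L) {r : ℝ} (h0 : 0 ≤ r) (h1 : r < 1) :
    ∑ l : Fin L, r ^ Nat.dist l j ≤ 2 / (1 - r) := by
  rw [← Finset.sum_filter_add_sum_filter_not Finset.univ (fun l => l ≤ j), div_eq_mul_inv, two_mul]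
  refine add_le_add (sum_pow_le_of_injOn _ _ ?_ h0 h1) (sum_pow_le_of_injOn _ _ ?_ h0 h1)
  all_goals
    intro x hx y hy hxy
    simp only [Finset.coe_filter, Finset.mem_univ, true_and, Set.mem_ofPred_eq] at hx hy
    simp only [Nat.dist] at hxy
    omega

/-- The `j`-th of `L` equidistant times in the `q`-th of `M` intervals of length `1 / M`. -/
noncomputable def gridTime (M L q j : ℕ) : ℝ := (q + j / L) / M

lemma gridTime_mem {M L q j : ℕ} (hj : j < L) (hM : 0 < M) :
    gridTime M L q j ∈ Set.Ico ((q : ℝ) / M) ((q + 1 : ℝ) / M) := by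
  have hL : (0 : ℝ) < L := by exact_mod_cast (Nat.zero_le j).trans_lt hj
  have h : (j : ℝ) / L < 1 := (div_lt_one hL).2 (by exact_mod_cast hj)
  have hM' : (0 : ℝ) < M := by exact_mod_cast hM
  unfold gridTime
  constructor
  · gcongr
    have : (0 : ℝ) ≤ (j : ℝ) / L := by positivity
    linarith
  · gcongr

lemma gridTime_mem_Icc {M L q j : ℕ} (hj : j < L) (hq : q < M) :
    gridTime M L q j ∈ Set.Icc (0 : ℝ) 1 := by
  have hM : 0 < M := (Nat.zero_le q).trans_lt hq
  have hM' : (0 : ℝ) < M := by exact_mod_cast hM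
  have h := gridTime_mem (q := q) hj hM
  refine ⟨le_trans (by positivity) h.1, h.2.le.trans ((div_le_one hM').2 ?_)⟩
  exact_mod_cast hq

lemma abs_gridTime_sub {M L : ℕ} (q i j : ℕ) :
    |gridTime M L q j - gridTime M L q i| = (Nat.dist j i : ℕ) / (M * L) := by
  have h : gridTime M L q j - gridTime M L q i = ((j : ℝ) - i) / (M * L) := by
    unfold gridTime
    rw [← sub_div, add_sub_add_left_eq_sub, ← sub_div, div_div, mul_comm (L : ℝ)]
  have h2 : |(j : ℝ) - i| = (Nat.dist j i : ℕ) := by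
    rcases le_total i j with hij | hij
    · have : (i : ℝ) ≤ j := by exact_mod_cast hij
      rw [abs_of_nonneg (by linarith), Nat.dist_eq_sub_of_le_right hij, Nat.cast_sub hij]
    · have : (j : ℝ) ≤ i := by exact_mod_cast hij
      rw [abs_of_nonpos (by linarith), Nat.dist_eq_sub_of_le hij, Nat.cast_sub hij]
      ring
  rw [h, abs_div, h2, abs_of_nonneg (by positivity)]

/-- The constant in the second moment bound for the number of unanimous tribes. -/
noncomputable def hitConst (M : ℕ) : ℝ := 2 / (1 - Real.exp (-(Real.exp (-2) / M)))

/-- Second moment for the `m * L` events, with mean `μ = m * L * 2⁻¹ ^ L`. Independent pairs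
contribute at most `μ ^ 2`. For one tribe the correlation decays geometrically in the grid distance,
with ratio `r` free of `L` because the grid spacing is `1 / (M * L)`; such pairs add at most `μ *
hitConst M`. -/
lemma walkLaw_no_hit_le {m L M q : ℕ} (hm : 0 < m) (hL : 0 < L) (hq : q < M) (c : ℤˣ) :
    (walkLaw (m * L)).real
      (⋃ x : Fin m × Fin L, tribeVotes m L c x.1 (gridTime M L q x.2))ᶜ ≤
      hitConst M / (m * L * 2⁻¹ ^ L) := by
  have hM' : (0 : ℝ) < M := by exact_mod_cast (Nat.zero_le q).trans_lt hq
  have hm' : (0 : ℝ) < m := by exact_mod_cast hm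
  have hL' : (0 : ℝ) < L := by exact_mod_cast hL
  set P := walkLaw (m * L)
  set E : Fin m × Fin L → Set (WalkSpace (m * L)) := fun x =>
    tribeVotes m L c x.1 (gridTime M L q x.2)
  set r := Real.exp (-(Real.exp (-2) / M)) with hr
  have hr1 : r < 1 := Real.exp_lt_one_iff.2 (neg_lt_zero.2 (div_pos (Real.exp_pos _) hM'))
  have h1 : ∑ x, P.real (E x) = m * L * 2⁻¹ ^ L := by
    simp [E, P, walkLaw_tribeVotes]
  -- The product term is kept for equal tribes too, so that its total is exactly `μ ^ 2`.
  have hpair (x y : Fin m × Fin L) : P.real (E x ∩ E y) ≤ 2⁻¹ ^ L * 2⁻¹ ^ L +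
      if x.1 = y.1 then 2⁻¹ ^ L * r ^ Nat.dist y.2 x.2 else 0 := by
    obtain ⟨a, i⟩ := x
    obtain ⟨b, j⟩ := y
    by_cases hab : a = b
    · subst hab
      have h := walkLaw_tribeVotes_inter_le (L := L) a c (gridTime_mem_Icc i.2 hq)
        (gridTime_mem_Icc j.2 hq)
      rw [abs_gridTime_sub] at h
      have e : Real.exp (-(Real.exp (-2) * ((Nat.dist j i : ℕ) / (M * L))) * L) =
          r ^ Nat.dist j i := by
        rw [hr, ← Real.exp_nat_mul]
        congr 1
        field_simp
      rw [e] at h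
      rw [if_pos rfl]
      exact h.trans (le_add_of_nonneg_left (by positivity))
    · rw [if_neg hab, add_zero]
      exact (walkLaw_tribeVotes_inter_of_ne hab c c _ _).le
  have h2 : ∑ x, ∑ y, P.real (E x ∩ E y) ≤
      (m * L * 2⁻¹ ^ L) ^ 2 + (m * L * 2⁻¹ ^ L) * hitConst M := by
    have h3 (x : Fin m × Fin L) : ∑ y, P.real (E x ∩ E y) ≤
        m * L * (2⁻¹ ^ L * 2⁻¹ ^ L) + 2⁻¹ ^ L * hitConst M := by
      refine (Finset.sum_le_sum fun y _ => hpair x y).trans ?_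
      rw [Finset.sum_add_distrib]
      refine add_le_add (by simp) ?_
      rw [Fintype.sum_prod_type, Finset.sum_eq_single x.1 (fun b _ hb => by simp [hb.symm])
        (fun h => absurd (Finset.mem_univ _) h)]
      simp only [if_true]
      rw [← Finset.mul_sum]
      gcongr
      exact sum_pow_dist_le x.2 (Real.exp_pos _).le hr1
    refine (Finset.sum_le_sum fun x _ => h3 x).trans (le_of_eq ?_)
    simp
    ring
  have h4 := sq_mul_measureReal_compl_iUnion_le P E fun x => measurableSet_tribeVotes _ _ _ _ _
  rw [h1] at h4
  have hpos : (0 : ℝ) < m * L * 2⁻¹ ^ L := by positivity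
  rw [le_div_iff₀ hpos]
  nlinarith

/-! ### Volatility -/

lemma lt_numChanges {g : ℝ → ℤˣ} {N : ℕ} (t : Fin (N + 2) → ℝ) (ht : StrictMono t)
    (h01 : ∀ i, t i ∈ Set.Icc (0 : ℝ) 1) (hg : ∀ i, g (t i) = (-1) ^ (i : ℕ)) :
    (N : ℕ∞) < numChanges g := by
  have h : ((N + 1 : ℕ) : ℕ∞) ≤ numChanges g := by
    refine le_iSup₂_of_le (N + 1) ⟨t, ht, h01, fun i => ?_⟩ le_rfl
    rw [hg, hg, Fin.val_castSucc, Fin.val_succ, pow_succ]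
    rcases Int.units_eq_one_or ((-1) ^ (i : ℕ)) with h | h <;> rw [h] <;> decide
  exact lt_of_lt_of_le (by exact_mod_cast N.lt_succ_self) h

lemma lt_walkChanges {m L N : ℕ} (p : WalkSpace (m * L))
    (hit : ∀ q : Fin (N + 2), ∀ c : ℤˣ, ∃ x : Fin m × Fin L,
      p ∈ tribeVotes m L c x.1 (gridTime (N + 2) L q x.2))
    (excl : ∀ q < N + 2, ∀ j : Fin L, ∀ a b : Fin m, a ≠ b →
      ¬ (p ∈ tribeVotes m L 1 a (gridTime (N + 2) L q j) ∧
        p ∈ tribeVotes m L (-1) b (gridTime (N + 2) L q j))) :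
    (N : ℕ∞) < walkChanges (tribesMajority m L) p := by
  choose x hx using hit
  let c : Fin (N + 2) → ℤˣ := fun q => (-1) ^ (q : ℕ)
  let t : Fin (N + 2) → ℝ := fun q => gridTime (N + 2) L q (x q (c q)).2
  have hM : (0 : ℝ) < (N + 2 : ℕ) := by positivity
  refine lt_numChanges t ?_ (fun q => gridTime_mem_Icc (x q (c q)).2.2 q.2) fun q => ?_
  · intro q q' hqq
    refine (gridTime_mem (x q (c q)).2.2 (Nat.succ_pos _)).2.trans_le
      (le_trans ?_ (gridTime_mem (x q' (c q')).2.2 (Nat.succ_pos _)).1)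
    gcongr
    exact_mod_cast Nat.succ_le_of_lt hqq
  · have h : walk p (t q) ∈ unanimous m L (c q) := ⟨_, hx q (c q)⟩
    change tribesMajority m L (walk p (t q)) = c q
    rcases Int.units_eq_one_or (c q) with hc | hc
    · rw [hc] at h ⊢
      exact if_pos h
    -- Since `1` has preference, the value `-1` requires that no tribe is unanimous for `1`: a
    -- different tribe is ruled out by `excl`, the same tribe by being nonempty.
    · have h1 : walk p (t q) ∉ unanimous m L 1 := by
        rintro ⟨a, ha⟩
        obtain ⟨b, hb⟩ := h
        rw [hc] at hb
        refine excl q q.2 (x q (c q)).2 a b ?_ ⟨ha, hb⟩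
        rintro rfl
        have i0 : 0 < (tribe m L a).card := by
          rw [card_tribe]; exact (Nat.zero_le _).trans_lt (x q (c q)).2.2
        obtain ⟨i, hi⟩ := Finset.card_pos.1 i0
        exact absurd ((ha i hi).symm.trans (hb i hi)) (by decide)
      rw [hc] at h ⊢
      exact (if_neg h1).trans (if_pos h)

/-- Union bound over the `N + 2` intervals: one of the two signs is never hit, or at one of the `L`
grid times two distinct tribes are unanimous for opposite signs. -/
lemma walkLaw_walkChanges_le {m L : ℕ} (hm : 0 < m) (hL : 0 < L) (N : ℕ) :
    (walkLaw (m * L)).real {p | walkChanges (tribesMajority m L) p ≤ (N : ℕ∞)} ≤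
      (N + 2) * (2 * (hitConst (N + 2) / (m * L * 2⁻¹ ^ L)) + L * (m * 2⁻¹ ^ L) ^ 2) := by
  set P := walkLaw (m * L)
  let H : ℕ → ℤˣ → Set (WalkSpace (m * L)) := fun q c =>
    (⋃ x : Fin m × Fin L, tribeVotes m L c x.1 (gridTime (N + 2) L q x.2))ᶜ
  let D : ℕ → Fin L → Fin m → Fin m → Set (WalkSpace (m * L)) := fun q j a b =>
    if a = b then ∅ else
      tribeVotes m L 1 a (gridTime (N + 2) L q j) ∩ tribeVotes m L (-1) b (gridTime (N + 2) L q j)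
  have hsub : {p | walkChanges (tribesMajority m L) p ≤ (N : ℕ∞)} ⊆
      ⋃ q : Fin (N + 2), ((⋃ c, H q c) ∪ ⋃ j, ⋃ a, ⋃ b, D q j a b) := by
    intro p hp
    by_contra hcon
    refine absurd (lt_walkChanges p (fun q c => ?_) fun q hq j a b hab hD => ?_) (not_lt.2 hp)
    · by_contra h
      refine hcon (Set.mem_iUnion.2 ⟨q, Or.inl (Set.mem_iUnion.2 ⟨c, fun h' => h ?_⟩)⟩)
      simpa using h'
    · refine hcon (Set.mem_iUnion.2 ⟨⟨q, hq⟩, Or.inr ?_⟩)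
      simp only [Set.mem_iUnion]
      refine ⟨j, a, b, ?_⟩
      simp only [D, if_neg hab]
      exact hD
  have hH (q : Fin (N + 2)) : P.real (⋃ c, H q c) ≤
      2 * (hitConst (N + 2) / (m * L * 2⁻¹ ^ L)) := by
    refine (measureReal_iUnion_fintype_le _).trans
      ((Finset.sum_le_sum fun c _ => walkLaw_no_hit_le hm hL q.2 c).trans (le_of_eq ?_))
    simp
  have hD (q : Fin (N + 2)) : P.real (⋃ j, ⋃ a, ⋃ b, D q j a b) ≤ L * (m * 2⁻¹ ^ L) ^ 2 := by
    have hab (j a b) : P.real (D q j a b) ≤ 2⁻¹ ^ L * 2⁻¹ ^ L := by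
      simp only [D]
      split_ifs with h
      · simp only [measureReal_empty]; positivity
      · exact (walkLaw_tribeVotes_inter_of_ne h _ _ _ _).le
    calc _ ≤ ∑ j, ∑ a, ∑ b, P.real (D q j a b) :=
          (measureReal_iUnion_fintype_le _).trans (Finset.sum_le_sum fun j _ =>
            (measureReal_iUnion_fintype_le _).trans (Finset.sum_le_sum fun a _ =>
              measureReal_iUnion_fintype_le _))
      _ ≤ ∑ j : Fin L, ∑ a : Fin m, ∑ b : Fin m, (2⁻¹ ^ L * 2⁻¹ ^ L : ℝ) := by
          gcongr
          exact hab _ _ _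
      _ = _ := by
          simp only [Finset.sum_const, Finset.card_univ, Fintype.card_fin, nsmul_eq_mul]
          ring
  calc _ ≤ P.real (⋃ q : Fin (N + 2), ((⋃ c, H q c) ∪ ⋃ j, ⋃ a, ⋃ b, D q j a b)) :=
        measureReal_mono hsub
    _ ≤ ∑ q : Fin (N + 2), P.real ((⋃ c, H q c) ∪ ⋃ j, ⋃ a, ⋃ b, D q j a b) :=
        measureReal_iUnion_fintype_le _
    _ ≤ ∑ q : Fin (N + 2), (2 * (hitConst (N + 2) / (m * L * 2⁻¹ ^ L)) +
          L * (m * 2⁻¹ ^ L) ^ 2) :=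
        Finset.sum_le_sum fun q _ => (measureReal_union_le _ _).trans (add_le_add (hH q) (hD q))
    _ = _ := by simp only [Finset.sum_const, Finset.card_univ, Fintype.card_fin, nsmul_eq_mul,
                  Nat.cast_add, Nat.cast_ofNat]

/-! ### Choice of the parameters. -/

/-- The size of the tribes in the `n`-th function. -/
def tribeSize (n : ℕ) : ℕ := 16 ^ n

/-- The number of tribes in the `n`-th function. -/
def tribeCount (n : ℕ) : ℕ := 2 ^ (tribeSize n - 3 * n)

/-- Ensures that the subtraction in `tribeCount` is not truncated. -/
lemma three_mul_le_tribeSize (n : ℕ) : 3 * n ≤ tribeSize n := by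
  induction n with
  | zero => simp
  | succ n ih =>
    have : 0 < tribeSize n := pow_pos (by norm_num) n
    have h : tribeSize (n + 1) = tribeSize n * 16 := pow_succ _ _
    omega

lemma tribeCount_mul (n : ℕ) :
    (tribeCount n : ℝ) * 2⁻¹ ^ tribeSize n = (1 / 8 : ℝ) ^ n := by
  have h : (2 : ℝ) ^ tribeSize n = 2 ^ (tribeSize n - 3 * n) * 8 ^ n := by
    rw [show (8 : ℝ) = 2 ^ 3 by norm_num, ← pow_mul, ← pow_add,
      Nat.sub_add_cancel (three_mul_le_tribeSize n)]
  rw [inv_pow, h, tribeCount, one_div, inv_pow]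
  push_cast
  field_simp

lemma volatile_tribesMajority :
    Volatile fun n => tribesMajority (tribeCount n) (tribeSize n) := by
  intro N
  have hb (n : ℕ) : (walkLaw (tribeCount n * tribeSize n)).real
      {p | walkChanges (tribesMajority (tribeCount n) (tribeSize n)) p ≤ (N : ℕ∞)} ≤
      (N + 2) * (2 * (hitConst (N + 2) * (1 / 2) ^ n) + (1 / 4) ^ n) := by
    refine (walkLaw_walkChanges_le (by simp [tribeCount]) (by simp [tribeSize]) N).trans_eq ?_
    have hL : (tribeSize n : ℝ) = 16 ^ n := by simp [tribeSize]
    have h1 : (tribeCount n : ℝ) * tribeSize n * 2⁻¹ ^ tribeSize n = 2 ^ n := by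
      rw [mul_right_comm, tribeCount_mul, hL, ← mul_pow]
      norm_num
    have h2 : (tribeSize n : ℝ) * (tribeCount n * 2⁻¹ ^ tribeSize n) ^ 2 = (1 / 4) ^ n := by
      rw [tribeCount_mul, hL, ← pow_mul, mul_comm n 2, pow_mul, ← mul_pow]
      norm_num
    rw [h1, h2, one_div_pow 2, div_eq_mul_one_div (hitConst _)]
  have hlim : Tendsto (fun n : ℕ => ((N : ℝ) + 2) * (2 * (hitConst (N + 2) * (1 / 2) ^ n) +
      (1 / 4) ^ n)) atTop (𝓝 0) := by
    have h1 := tendsto_pow_atTop_nhds_zero_of_lt_one (r := (1 / 2 : ℝ)) (by norm_num) (by norm_num)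
    have h2 := tendsto_pow_atTop_nhds_zero_of_lt_one (r := (1 / 4 : ℝ)) (by norm_num) (by norm_num)
    simpa using (((h1.const_mul (hitConst (N + 2))).const_mul 2).add h2).const_mul ((N : ℝ) + 2)
  have := squeeze_zero (fun n => measureReal_nonneg) hb hlim
  rw [← ENNReal.tendsto_toReal_iff (fun n => measure_ne_top _ _) ENNReal.zero_ne_top]
  exact this

/-! ### Sums of independent signs -/

/-- The sum of the bits with index in `S`, as a real number. -/
noncomputable def bitSum {k : ℕ} (S : Finset (Fin k)) (ω : Cube k) : ℝ := ∑ i ∈ S, ((ω i : ℤ) : ℝ)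

open Classical in
lemma uniformCube_real_apply {k : ℕ} (s : Set (Cube k)) :
    (uniformCube k).real s = (Finset.univ.filter (· ∈ s)).card / 2 ^ k := by
  rw [measureReal_def, uniformCube_apply]
  simp

lemma sum_bit_mul_bit_of_ne {k : ℕ} {i j : Fin k} (hij : i ≠ j) :
    ∑ ω : Cube k, ((ω i : ℤ) : ℝ) * ((ω j : ℤ) : ℝ) = 0 := by
  -- Flipping bit `i` is a bijection of the cube that negates the sum.
  have h := Equiv.sum_comp (Equiv.mulLeft (Function.update (1 : Cube k) i (-1)))
    fun ω : Cube k => ((ω i : ℤ) : ℝ) * ((ω j : ℤ) : ℝ)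
  simp only [Equiv.coe_mulLeft, Pi.mul_apply, Function.update_self,
    Function.update_of_ne hij.symm, Pi.one_apply, one_mul, neg_mul, Units.val_neg, Int.cast_neg,
    Finset.sum_neg_distrib] at h
  linarith

lemma bit_mul_self (x : ℤˣ) : ((x : ℤ) : ℝ) * ((x : ℤ) : ℝ) = 1 := by
  rw [← Int.cast_mul, ← Units.val_mul, Int.units_mul_self]
  simp

lemma sum_bitSum_sq {k : ℕ} (S : Finset (Fin k)) :
    ∑ ω : Cube k, bitSum S ω ^ 2 = 2 ^ k * S.card := by
  have h (i) (hi : i ∈ S) :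
      ∑ j ∈ S, ∑ ω : Cube k, ((ω i : ℤ) : ℝ) * ((ω j : ℤ) : ℝ) = 2 ^ k := by
    rw [Finset.sum_eq_single i (fun j _ hj => sum_bit_mul_bit_of_ne hj.symm)
      (fun h => absurd hi h)]
    simp only [bit_mul_self]
    simp
  simp only [bitSum, sq, Finset.sum_mul_sum]
  rw [Finset.sum_comm]
  simp only [Finset.sum_comm (s := (Finset.univ : Finset (Cube k)))]
  rw [Finset.sum_congr rfl h]
  simp [mul_comm]

lemma uniformCube_le_abs_bitSum {k : ℕ} (S : Finset (Fin k)) {r : ℝ} (hr : 0 < r) :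
    (uniformCube k).real {ω | r ≤ |bitSum S ω|} ≤ S.card / r ^ 2 := by
  classical
  rw [uniformCube_real_apply, div_le_div_iff₀ (by positivity) (by positivity),
    mul_comm (S.card : ℝ), ← sum_bitSum_sq S, ← nsmul_eq_mul]
  refine (Finset.card_nsmul_le_sum _ (fun ω => bitSum S ω ^ 2) _ fun ω hω => ?_).trans
    (Finset.sum_le_univ_sum_of_nonneg fun ω => sq_nonneg _)
  rw [← sq_abs (bitSum S ω)]
  have : r ≤ |bitSum S ω| := by simpa using hω
  gcongr

/-! ### Anti-concentration of the sum of all bits. -/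

lemma centralBinom_sq_le (h : ℕ) : (2 * h + 1) * h.centralBinom ^ 2 ≤ 16 ^ h := by
  induction h with
  | zero => simp
  | succ h ih =>
    refine Nat.le_of_mul_le_mul_left ?_ (pow_pos h.succ_pos 2)
    calc (h + 1) ^ 2 * ((2 * (h + 1) + 1) * (h + 1).centralBinom ^ 2)
        = (2 * h + 3) * ((h + 1) * (h + 1).centralBinom) ^ 2 := by ring
      _ = (4 * ((2 * h + 3) * (2 * h + 1))) * ((2 * h + 1) * h.centralBinom ^ 2) := by
          rw [Nat.succ_mul_centralBinom_succ]; ring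
      _ ≤ (16 * (h + 1) ^ 2) * 16 ^ h := by
          -- This is `(2 * h + 1) * (2 * h + 3) ≤ 4 * (h + 1) ^ 2`; with `2 * h` in place of `2 * h
          -- + 1` in the statement the induction would not close.
          refine Nat.mul_le_mul ?_ ih
          nlinarith
      _ = (h + 1) ^ 2 * 16 ^ (h + 1) := by ring

lemma choose_le_of_even {k : ℕ} (hk : Even k) (hk0 : 0 < k) (j : ℕ) :
    (k.choose j : ℝ) ≤ 2 ^ k / √k := by
  obtain ⟨h, rfl⟩ := hk
  have h1 : (h + h).choose j ≤ h.centralBinom := by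
    rw [← two_mul]; exact Nat.choose_le_centralBinom j h
  have h2 : (((h + h : ℕ) : ℝ)) * (h.centralBinom : ℝ) ^ 2 ≤ (2 ^ (h + h)) ^ 2 := by
    have h3 := centralBinom_sq_le h
    have h4 : (h + h) * h.centralBinom ^ 2 ≤ (2 ^ (h + h)) ^ 2 := by
      calc _ ≤ (2 * h + 1) * h.centralBinom ^ 2 := Nat.mul_le_mul_right _ (by omega)
        _ ≤ 16 ^ h := h3
        _ = _ := by rw [← pow_mul, show (16 : ℕ) = 2 ^ 4 by norm_num, ← pow_mul]; ring_nf
    exact_mod_cast h4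
  have hpos : (0 : ℝ) < √((h + h : ℕ) : ℝ) := Real.sqrt_pos.2 (by exact_mod_cast hk0)
  calc ((h + h).choose j : ℝ) ≤ h.centralBinom := by exact_mod_cast h1
    _ ≤ _ := by
      rw [le_div_iff₀ hpos]
      refine le_of_sq_le_sq ?_ (by positivity)
      rw [mul_pow, Real.sq_sqrt (by positivity), mul_comm]
      exact h2

lemma bitSum_univ {k : ℕ} (ω : Cube k) :
    bitSum Finset.univ ω = 2 * ((Finset.univ.filter fun i => ω i = 1).card : ℝ) - k := by
  have h (i : Fin k) : ((ω i : ℤ) : ℝ) = 2 * (if ω i = 1 then 1 else 0) - 1 := by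
    rcases Int.units_eq_one_or (ω i) with h | h <;> rw [h] <;> norm_num
  simp only [bitSum, h, Finset.sum_sub_distrib, ← Finset.mul_sum, Finset.sum_boole]
  simp

lemma card_filter_card_eq_le (k j : ℕ) :
    (Finset.univ.filter fun ω : Cube k => (Finset.univ.filter fun i => ω i = 1).card = j).card ≤
      k.choose j := by
  calc _ ≤ (Finset.powersetCard j (Finset.univ : Finset (Fin k))).card := by
        refine Finset.card_le_card_of_injOn (fun ω => Finset.univ.filter fun i => ω i = 1)
          (fun ω hω => ?_) fun ω _ ω' _ h => ?_
        · simpa [Finset.mem_powersetCard] using hω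
        · ext1 i
          have h1 : ω i = 1 ↔ ω' i = 1 := by
            simpa using congrArg (i ∈ ·) h
          rcases Int.units_eq_one_or (ω i) with h2 | h2 <;>
            rcases Int.units_eq_one_or (ω' i) with h3 | h3 <;> simp_all
    _ = k.choose j := by simp

/-- The number of bits equal to `1` is confined to a window of length `r`, which contains at most `r
+ 1` integers, each of mass at most `1 / √k`. -/
lemma uniformCube_abs_bitSum_le {k : ℕ} (hk : Even k) (hk0 : 0 < k) {r : ℝ} (hr : 0 ≤ r) :
    (uniformCube k).real {ω | |bitSum Finset.univ ω| ≤ r} ≤ (r + 1) / √k := by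
  classical
  let J : Cube k → ℤ := fun ω => (Finset.univ.filter fun i => ω i = 1).card
  let W : Finset ℤ := Finset.Icc ⌈(k - r) / 2⌉ ⌊(k + r) / 2⌋
  have hJ : ∀ ω ∈ Finset.univ.filter (· ∈ {ω : Cube k | |bitSum Finset.univ ω| ≤ r}), J ω ∈ W := by
    intro ω hω
    have h1 : |bitSum Finset.univ ω| ≤ r := by simpa using hω
    rw [bitSum_univ, abs_le] at h1
    refine Finset.mem_Icc.2 ⟨Int.ceil_le.2 ?_, Int.le_floor.2 ?_⟩ <;>
      simp only [J, Int.cast_natCast] <;> linarith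
  have hW : (W.card : ℝ) ≤ r + 1 := by
    have h1 : (W.card : ℝ) = ((W.card : ℤ) : ℝ) := by simp
    rw [h1, Int.card_Icc, Int.toNat_eq_max, Int.cast_max, Int.cast_zero]
    refine max_le ?_ (by linarith)
    push_cast
    have h2 := Int.floor_le (((k : ℝ) + r) / 2)
    have h3 := Int.le_ceil (((k : ℝ) - r) / 2)
    linarith
  have hfib (z : ℤ) : ((Finset.univ.filter fun ω : Cube k => J ω = z).card : ℝ) ≤ 2 ^ k / √k := by
    rcases lt_or_ge z 0 with hz | hz
    · rw [Finset.filter_false_of_mem fun ω _ h => absurd (Int.natCast_nonneg _) (by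
        rw [← h] at hz; exact not_le.2 hz)]
      simp
      positivity
    · lift z to ℕ using hz
      refine le_trans ?_ (choose_le_of_even hk hk0 z)
      have := card_filter_card_eq_le k z
      simp only [J, Nat.cast_inj]
      exact_mod_cast this
  rw [uniformCube_real_apply, div_le_iff₀ (by positivity),
    Finset.card_eq_sum_card_fiberwise hJ]
  push_cast
  calc _ ≤ ∑ z ∈ W, (2 ^ k / √k : ℝ) := by
        refine Finset.sum_le_sum fun z _ => le_trans ?_ (hfib z)
        exact_mod_cast Finset.card_le_card (Finset.filter_subset_filter _ (Finset.subset_univ _))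
    _ = W.card * (2 ^ k / √k) := by simp
    _ ≤ (r + 1) * (2 ^ k / √k) := by gcongr
    _ = _ := by ring

/-! ### The noise -/

lemma disagreement_eq {k : ℕ} (f : Cube k → ℤˣ) (ε : I) :
    disagreement f ε = ∫⁻ b, (uniformCube k).prod (uniformCube k)
      {x | f x.1 ≠ f (resample x.1 b x.2)}
        ∂Measure.pi fun _ : Fin k => bernoulliMeasure true false ε := by
  have hs (s : Set (Cube k × (Fin k → Bool) × Cube k)) : MeasurableSet s := s.toFinite.measurableSet
  have hs' (s : Set ((Fin k → Bool) × Cube k)) : MeasurableSet s := s.toFinite.measurableSet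
  have hs'' (s : Set (Cube k × Cube k)) : MeasurableSet s := s.toFinite.measurableSet
  rw [disagreement, noiseLaw, Measure.prod_apply (hs _)]
  simp only [Measure.prod_apply (hs' _), Measure.prod_apply (hs'' _)]
  rw [lintegral_lintegral_swap]
  · rfl
  · exact (measurable_of_finite _).aemeasurable

lemma integral_card_marked (k : ℕ) (ε : I) :
    ∫ b : Fin k → Bool, ((Finset.univ.filter fun i => b i = true).card : ℝ)
      ∂(Measure.pi fun _ : Fin k => bernoulliMeasure true false ε) = k * ε := by
  have h (b : Fin k → Bool) : ((Finset.univ.filter fun i => b i = true).card : ℝ) =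
      ∑ i, {b : Fin k → Bool | b i = true}.indicator (fun _ => (1 : ℝ)) b := by
    simp [Set.indicator_apply, Finset.sum_boole]
  have h2 (i : Fin k) : (Measure.pi fun _ : Fin k => bernoulliMeasure true false ε).real
      {b : Fin k → Bool | b i = true} = ε := by
    have := (measurePreserving_eval (fun _ : Fin k => bernoulliMeasure true false ε)
      i).measureReal_preimage (s := {true}) (measurableSet_singleton _).nullMeasurableSet
    rw [bernoulliMeasure_real_apply_of_mem_of_notMem _ (by simp) (by simp) (by simp)] at this
    exact this
  simp only [h]
  rw [integral_finsetSum _ fun i _ => Integrable.of_finite]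
  have h3 (i : Fin k) : ∫ b : Fin k → Bool, {b : Fin k → Bool | b i = true}.indicator
      (fun _ => (1 : ℝ)) b ∂(Measure.pi fun _ : Fin k => bernoulliMeasure true false ε) = ε := by
    rw [← h2 i]
    exact integral_indicator_one (Set.toFinite _).measurableSet
  simp [h3]

/-- Conditioning on the marks reduces noise stability to a bound affine in the number of marked
bits, whose mean is `k * ε`. -/
lemma disagreement_le {k : ℕ} (f : Cube k → ℤˣ) (ε : I) {α β : ℝ}
    (h : ∀ b, ((uniformCube k).prod (uniformCube k)).real {x | f x.1 ≠ f (resample x.1 b x.2)} ≤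
      α + β * (Finset.univ.filter fun i => b i = true).card) :
    disagreement f ε ≤ ENNReal.ofReal (α + β * (k * ε)) := by
  rw [disagreement_eq]
  calc _ ≤ ∫⁻ b : Fin k → Bool, ENNReal.ofReal
          (α + β * (Finset.univ.filter fun i => b i = true).card)
          ∂(Measure.pi fun _ : Fin k => bernoulliMeasure true false ε) :=
        lintegral_mono fun b => by
          rw [← ofReal_measureReal]
          exact ENNReal.ofReal_le_ofReal (h b)
    _ = _ := by
        rw [← ofReal_integral_eq_lintegral_ofReal Integrable.of_finite
          (ae_of_all _ fun b => measureReal_nonneg.trans (h b)),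
          integral_add Integrable.of_finite Integrable.of_finite, integral_const_mul,
          integral_card_marked]
        simp

lemma prod_real_fst {k : ℕ} (s : Set (Cube k)) :
    ((uniformCube k).prod (uniformCube k)).real {x | x.1 ∈ s} = (uniformCube k).real s := by
  have : {x : Cube k × Cube k | x.1 ∈ s} = s ×ˢ Set.univ := by ext; simp
  rw [this, measureReal_prod_prod]
  simp

lemma prod_real_snd {k : ℕ} (s : Set (Cube k)) :
    ((uniformCube k).prod (uniformCube k)).real {x | x.2 ∈ s} = (uniformCube k).real s := by
  have : {x : Cube k × Cube k | x.2 ∈ s} = Set.univ ×ˢ s := by ext; simp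
  rw [this, measureReal_prod_prod]
  simp

lemma map_resample {k : ℕ} (b : Fin k → Bool) :
    ((uniformCube k).prod (uniformCube k)).map (fun x => resample x.1 b x.2) = uniformCube k := by
  refine Measure.ext_of_singleton fun c => ?_
  rw [Measure.map_apply (measurable_of_finite _) (measurableSet_singleton _)]
  let S := Finset.univ.filter fun i => b i = true
  let S' := Finset.univ.filter fun i => ¬ b i = true
  have h1 : (fun x : Cube k × Cube k => resample x.1 b x.2) ⁻¹' {c} =
      {ω | ∀ i ∈ S', ω i = c i} ×ˢ {ω | ∀ i ∈ S, ω i = c i} := by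
    ext x
    simp only [Set.mem_preimage, Set.mem_singleton_iff, funext_iff, Set.mem_prod, Set.mem_ofPred_eq,
      ← forall_and, S, S', Finset.mem_filter, Finset.mem_univ, true_and]
    refine forall_congr' fun i => ?_
    by_cases hb : b i = true <;> simp [resample, hb]
  have h2 : {c} = {ω : Cube k | ∀ i ∈ Finset.univ, ω i = c i} := by
    ext x; simp [funext_iff]
  rw [h1, h2, Measure.prod_prod, uniformCube_cylinder, uniformCube_cylinder, uniformCube_cylinder,
    ← pow_add, add_comm, Finset.card_filter_add_card_filter_not]

lemma prod_real_resample {k : ℕ} (b : Fin k → Bool) (s : Set (Cube k)) :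
    ((uniformCube k).prod (uniformCube k)).real {x | resample x.1 b x.2 ∈ s} =
      (uniformCube k).real s := by
  nth_rw 3 [← map_resample b]
  rw [map_measureReal_apply (measurable_of_finite _) s.toFinite.measurableSet]
  rfl

/-- Nothing changes unless some bit is marked. This crude bound serves the finitely many small `n`.
-/
lemma disagreement_le_mul {k : ℕ} (f : Cube k → ℤˣ) (ε : I) :
    disagreement f ε ≤ ENNReal.ofReal (k * ε) := by
  have := disagreement_le f ε (α := 0) (β := 1) fun b => ?_
  · simpa using this
  · rw [zero_add, one_mul]
    by_cases hb : ∃ i, b i = true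
    · have h1 : 1 ≤ (Finset.univ.filter fun i => b i = true).card :=
        Finset.card_pos.2 (by simpa [Finset.filter_nonempty_iff] using hb)
      exact measureReal_le_one.trans (by exact_mod_cast h1)
    · have : {x : Cube k × Cube k | f x.1 ≠ f (resample x.1 b x.2)} = ∅ := by
        refine Set.eq_empty_of_forall_notMem fun x hx => hx ?_
        congr 1
        ext1 i
        simp [resample, not_exists.1 hb i]
      rw [this, measureReal_empty]
      positivity

/-! ### Noise stability of majority and of its modification. -/

lemma majority_ne_le {k : ℕ} (hk : Even k) (hk0 : 0 < k) (b : Fin k → Bool) {r : ℝ} (hr : 0 < r) :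
    ((uniformCube k).prod (uniformCube k)).real
      {x | majority k x.1 ≠ majority k (resample x.1 b x.2)} ≤
      (r + 1) / √k + 8 / r ^ 2 * (Finset.univ.filter fun i => b i = true).card := by
  set S := Finset.univ.filter fun i => b i = true
  have hmaj (ω : Cube k) : majority k ω = if 0 ≤ bitSum Finset.univ ω then 1 else -1 := by
    simp only [majority, bitSum]
    congr 1
    exact_mod_cast rfl
  have hsum (x : Cube k × Cube k) : bitSum Finset.univ x.1 -
      bitSum Finset.univ (resample x.1 b x.2) = bitSum S x.1 - bitSum S x.2 := by
    simp only [bitSum, ← Finset.sum_sub_distrib, S, Finset.sum_filter]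
    refine Finset.sum_congr rfl fun i _ => ?_
    by_cases hb : b i = true <;> simp [resample, hb]
  -- Resampling changes the total by the difference of the old and new sums over `S`. If the total
  -- exceeds `r` in absolute value, a change of sign forces one of these sums to reach `r / 2`;
  -- Chebyshev bounds each case by `4 * |S| / r ^ 2`.
  have hsub : {x : Cube k × Cube k | majority k x.1 ≠ majority k (resample x.1 b x.2)} ⊆
      {x | x.1 ∈ {ω : Cube k | |bitSum Finset.univ ω| ≤ r}} ∪
      ({x | x.1 ∈ {ω : Cube k | r / 2 ≤ |bitSum S ω|}} ∪
        {x | x.2 ∈ {ω : Cube k | r / 2 ≤ |bitSum S ω|}}) := by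
    intro x hx
    by_contra hcon
    simp only [Set.mem_union, Set.mem_ofPred_eq, not_or, not_le] at hcon
    obtain ⟨h1, h2, h3⟩ := hcon
    have h4 := hsum x
    rw [abs_lt] at h2 h3
    refine hx ?_
    rw [hmaj, hmaj]
    rcases lt_abs.1 h1 with h5 | h5
    · rw [if_pos (by linarith), if_pos (by linarith)]
    · rw [if_neg (by linarith), if_neg (by linarith)]
  have h5 := uniformCube_le_abs_bitSum S (half_pos hr)
  refine (measureReal_mono hsub).trans ((measureReal_union_le _ _).trans
    ((add_le_add_right (measureReal_union_le _ _) _).trans ?_))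
  rw [prod_real_fst, prod_real_fst, prod_real_snd]
  have h6 : (S.card : ℝ) / (r / 2) ^ 2 = 4 / r ^ 2 * S.card := by
    field_simp
    norm_num
  have h7 := uniformCube_abs_bitSum_le hk hk0 hr.le
  rw [h6] at h5
  have h8 : 8 / r ^ 2 * (S.card : ℝ) = 2 * (4 / r ^ 2 * S.card) := by ring
  linarith

lemma uniformCube_unanimous_le (m L : ℕ) (c : ℤˣ) :
    (uniformCube (m * L)).real (unanimous m L c) ≤ m * 2⁻¹ ^ L := by
  have h : unanimous m L c = ⋃ a, {ω | ∀ i ∈ tribe m L a, ω i = c} := by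
    ext; simp [unanimous]
  rw [h]
  refine (measureReal_iUnion_fintype_le _).trans (le_of_eq ?_)
  have h2 (a : Fin m) : (uniformCube (m * L)).real {ω | ∀ i ∈ tribe m L a, ω i = c} = 2⁻¹ ^ L := by
    rw [measureReal_def, uniformCube_cylinder _ fun _ => c, card_tribe]
    simp
  simp [h2]

lemma tribesMajority_ne_majority_le (m L : ℕ) :
    (uniformCube (m * L)).real {ω | tribesMajority m L ω ≠ majority (m * L) ω} ≤
      2 * (m * 2⁻¹ ^ L) := by
  have hsub : {ω | tribesMajority m L ω ≠ majority (m * L) ω} ⊆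
      unanimous m L 1 ∪ unanimous m L (-1) := by
    intro ω hω
    by_contra hcon
    rw [Set.mem_union, not_or] at hcon
    exact hω ((if_neg hcon.1).trans (if_neg hcon.2))
  rw [two_mul]
  exact (measureReal_mono hsub).trans ((measureReal_union_le _ _).trans
    (add_le_add (uniformCube_unanimous_le m L 1) (uniformCube_unanimous_le m L (-1))))

/-- Both the original and the resampled configuration are uniform, so replacing the function by
majority costs `2 * (m * 2⁻¹ ^ L)` for each. -/
lemma disagreement_tribesMajority_le {m L : ℕ} (hk : Even (m * L)) (hk0 : 0 < m * L) (ε : I)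
    {r : ℝ} (hr : 0 < r) :
    disagreement (tribesMajority m L) ε ≤ ENNReal.ofReal
      (4 * (m * 2⁻¹ ^ L) + (r + 1) / √(m * L : ℕ) + 8 / r ^ 2 * ((m * L : ℕ) * ε)) := by
  refine disagreement_le _ ε fun b => ?_
  set D : Set (Cube (m * L)) := {ω | tribesMajority m L ω ≠ majority (m * L) ω}
  have hsub : {x : Cube (m * L) × Cube (m * L) |
      tribesMajority m L x.1 ≠ tribesMajority m L (resample x.1 b x.2)} ⊆
      ({x | x.1 ∈ D} ∪ {x | resample x.1 b x.2 ∈ D}) ∪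
        {x | majority (m * L) x.1 ≠ majority (m * L) (resample x.1 b x.2)} := by
    intro x hx
    by_contra hcon
    simp only [Set.mem_union, Set.mem_ofPred_eq, not_or, not_not, D] at hcon
    exact hx (hcon.1.1.trans (hcon.2.trans hcon.1.2.symm))
  have h1 := measureReal_mono (μ := (uniformCube (m * L)).prod (uniformCube (m * L))) hsub
  have h2 := measureReal_union_le (μ := (uniformCube (m * L)).prod (uniformCube (m * L)))
    ({x | x.1 ∈ D} ∪ {x | resample x.1 b x.2 ∈ D})
    {x | majority (m * L) x.1 ≠ majority (m * L) (resample x.1 b x.2)}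
  have h3 := measureReal_union_le (μ := (uniformCube (m * L)).prod (uniformCube (m * L)))
    {x | x.1 ∈ D} {x | resample x.1 b x.2 ∈ D}
  rw [prod_real_fst, prod_real_resample] at h3
  have h4 := tribesMajority_ne_majority_le m L
  have h5 := majority_ne_le hk hk0 b hr
  linarith

lemma disagreement_tribes_le {n : ℕ} (ε : I) {δ : ℝ} (hδ : 0 < δ) :
    disagreement (tribesMajority (tribeCount n) (tribeSize n)) ε ≤
      ENNReal.ofReal (δ + 5 * (1 / 4) ^ n + 8 / δ ^ 2 * ε) := by
  have hL : tribeSize n = 16 ^ n := rfl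
  have hm : 1 ≤ tribeCount n := Nat.one_le_two_pow
  have hk0 : 0 < tribeCount n * tribeSize n := Nat.mul_pos hm (by simp [hL])
  have hk : Even (tribeCount n * tribeSize n) := by
    -- For `n = 0` the tribes have size `1`, and evenness comes from the tribe count `2`.
    rcases n with _ | n
    · decide
    · exact Even.mul_left ((by decide : Even 16).pow_of_ne_zero n.succ_ne_zero) _
  have hK : (16 : ℝ) ^ n ≤ (tribeCount n * tribeSize n : ℕ) := by
    have : 16 ^ n ≤ tribeCount n * tribeSize n := hL ▸ Nat.le_mul_of_pos_left _ hm
    exact_mod_cast this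
  set K : ℝ := ((tribeCount n * tribeSize n : ℕ) : ℝ) with hKdef
  have hKpos : 0 < K := lt_of_lt_of_le (by positivity) hK
  have hs : (4 : ℝ) ^ n ≤ √K := by
    refine Real.le_sqrt_of_sq_le ?_
    rw [← pow_mul, mul_comm, pow_mul]
    norm_num
    exact hK
  have hs0 : 0 < √K := Real.sqrt_pos.2 hKpos
  -- The threshold `r = δ * √K` makes `r / √K = δ` and cancels the dimension in the Chebyshev term,
  -- leaving a bound uniform in `n`.
  refine (disagreement_tribesMajority_le hk hk0 ε (mul_pos hδ hs0)).trans
    (ENNReal.ofReal_le_ofReal ?_)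
  rw [← hKdef, tribeCount_mul, add_div, mul_div_cancel_right₀ _ hs0.ne', mul_pow,
    Real.sq_sqrt hKpos.le]
  have h1 : 1 / √K ≤ (1 / 4) ^ n := by
    rw [one_div_pow]
    exact one_div_le_one_div_of_le (by positivity) hs
  have h2 : (1 / 8 : ℝ) ^ n ≤ (1 / 4) ^ n := by gcongr; norm_num
  have h3 : 8 / (δ ^ 2 * K) * (K * ε) = 8 / δ ^ 2 * ε := by field_simp
  rw [h3]
  linarith

lemma noiseStable_tribesMajority :
    NoiseStable fun n => tribesMajority (tribeCount n) (tribeSize n) := by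
  refine ENNReal.tendsto_nhds_zero.2 fun η hη => ?_
  obtain ⟨δ', hδ', hδη⟩ := ENNReal.lt_iff_exists_nnreal_btwn.1 hη
  have hpos : (0 : ℝ) < δ' := by exact_mod_cast hδ'
  -- One third for each term of `disagreement_tribes_le`; the middle one is small only from some
  -- `n₀` on.
  obtain ⟨δ, hδ⟩ : ∃ δ : ℝ, δ = δ' / 3 := ⟨_, rfl⟩
  have hδ0 : 0 < δ := by rw [hδ]; positivity
  have hlim : Tendsto (fun n : ℕ => 5 * (1 / 4 : ℝ) ^ n) atTop (𝓝 0) := by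
    simpa using (tendsto_pow_atTop_nhds_zero_of_lt_one (r := (1 / 4 : ℝ)) (by norm_num)
      (by norm_num)).const_mul 5
  obtain ⟨n₀, hn₀⟩ := eventually_atTop.1 (hlim.eventually_le_const hδ0)
  have hcoe : Tendsto (fun ε : I => (ε : ℝ)) (𝓝[>] 0) (𝓝 0) :=
    (continuous_subtype_val.tendsto (0 : I)).mono_left nhdsWithin_le_nhds
  have hsmall (C : ℝ) : ∀ᶠ ε : I in 𝓝[>] 0, C * (ε : ℝ) ≤ δ := by
    have := hcoe.const_mul C
    rw [mul_zero] at this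
    exact this.eventually_le_const hδ0
  have hfin : ∀ᶠ ε : I in 𝓝[>] 0, ∀ n ∈ Finset.range n₀,
      ((tribeCount n * tribeSize n : ℕ) : ℝ) * (ε : ℝ) ≤ δ :=
    (Finset.eventually_all _).2 fun n _ => hsmall _
  filter_upwards [hfin, hsmall (8 / δ ^ 2)] with ε h1 h2
  refine iSup_le fun n => le_trans ?_ hδη.le
  rw [← ENNReal.ofReal_coe_nnreal]
  rcases lt_or_ge n n₀ with hn | hn
  · refine (disagreement_le_mul _ ε).trans (ENNReal.ofReal_le_ofReal ?_)
    have := h1 n (Finset.mem_range.2 hn)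
    linarith
  · refine (disagreement_tribes_le ε hδ0).trans (ENNReal.ofReal_le_ofReal ?_)
    have := hn₀ n hn
    linarith

end BooleanFunctions

theorem mainTheorem3 :
    ∃ (k : ℕ → ℕ) (f : ∀ n, BooleanFunctions.Cube (k n) → ℤˣ),
      (∀ n, 0 < k n) ∧
      (∀ n, BooleanFunctions.IsTransitive (f n)) ∧
      (∀ n, Monotone (f n)) ∧
      BooleanFunctions.NoiseStable f ∧
      BooleanFunctions.Volatile f := by
  open BooleanFunctions in
  exact ⟨fun n => tribeCount n * tribeSize n, fun n => tribesMajority (tribeCount n) (tribeSize n),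
    fun n => by simp [tribeCount, tribeSize], fun n => isTransitive_tribesMajority _ _,
    fun n => monotone_tribesMajority _ _, noiseStable_tribesMajority, volatile_tribesMajority⟩
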